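/- Let $E$ be a Dedekind complete Riesz space (real vector lattice) with weak order unit $e$. Let $T:E\to E$ be a strictly positive conditional expectation operator with $Te=e$, that is: $T$ is a linear, positive, order continuous projection which maps weak order units to weak order units, whose range $R(T)$ is a Dedekind complete Riesz subspace of $E$, and such that $f\ge 0$, $Tf=0$ imply $f=0$. Let $S:E\to E$ be an order continuous Riesz homomorphism with $Se=e$ and $TSf=Tf$ for all $f\in E$, so that $(E,T,S,e)$ is a conditional expectation preserving system. Assume that the system is conditionally ergodic, i.e. for every $f\in E$ the Cesàro means $\frac1m\sum_{k=0}^{m-1}S^kf$ converge in order to $Tf$ as $m\to\infty$, and that $S$ is surjective. (Neither aperiodicity nor $T$-universal completeness of $E$ is assumed.) Let $n\ge 1$ be an integer and let $p$ be a component of $e$, i.e. $0\le p\le e$ and $(e-p)\wedge p=0$. Write $P_{Tp}$ for the band projection of $E$ onto the band generated by $Tp$. Then there exists a component $q$ of $P_{Tp}e$ such that $q, Sq,\dots,S^{n-1}q$ are pairwise disjoint and $$T\Bigl(\bigvee_{j=0}^{n-1}S^jq\Bigr)\ \ge\ \bigl(P_{Tp}e-(n-1)Tp\bigr)^+ .$$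 -/

import Mathlib

/-!
Throughout, a Dedekind complete Riesz space is a real vector space `E` with a compatible
conditionally complete lattice order:
`[AddCommGroup E] [ConditionallyCompleteLattice E] [IsOrderedAddMonoid E] [Module ℝ E]
[IsOrderedModule ℝ E]`.
-/

namespace RieszErgodic

noncomputable section

section Riesz

variable {E : Type*} [AddCommGroup E] [Lattice E]

/-- Disjointness `f ⊥ g` in a Riesz space. -/
def RieszDisjoint (f g : E) : Prop := |f| ⊓ |g| = 0

/-- `e` is a weak order unit: it is positive and only `0` is disjoint from it. -/
def IsWeakOrderUnit (e : E) : Prop := 0 ≤ e ∧ ∀ f : E, RieszDisjoint f e → f = 0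

/-- `p` is a component of `q`. -/
def IsComponent (p q : E) : Prop := 0 ≤ p ∧ p ≤ q ∧ (q - p) ⊓ p = 0

/-- Order convergence of a sequence. -/
def OrderTendsto (x : ℕ → E) (l : E) : Prop :=
  ∃ y : ℕ → E, Antitone y ∧ IsGLB (Set.range y) 0 ∧ ∀ n, |x n - l| ≤ y n

variable [Module ℝ E]

/-- A positive linear operator. -/
def IsPositiveOp (T : E →ₗ[ℝ] E) : Prop := ∀ f, 0 ≤ f → 0 ≤ T f

/-- A strictly positive operator: positive, and `T f = 0` with `0 ≤ f` forces `f = 0`. -/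
def IsStrictlyPositiveOp (T : E →ₗ[ℝ] E) : Prop :=
  IsPositiveOp T ∧ ∀ f, 0 ≤ f → T f = 0 → f = 0

/-- Order continuity of a positive operator: `D ↓ 0` implies `T D ↓ 0` for every downwards
directed set `D`. -/
def IsOrderContinuous (T : E →ₗ[ℝ] E) : Prop :=
  ∀ D : Set E, D.Nonempty → DirectedOn (· ≥ ·) D → IsGLB D 0 → IsGLB (T '' D) 0

/-- A Riesz (lattice) homomorphism. -/
def IsRieszHom (S : E →ₗ[ℝ] E) : Prop :=
  ∀ f g, S (f ⊔ g) = S f ⊔ S g ∧ S (f ⊓ g) = S f ⊓ S g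

/-- A Riesz subspace: a linear subspace closed under the lattice operations of `E`. -/
def IsRieszSubspace (F : Submodule ℝ E) : Prop :=
  ∀ f ∈ F, ∀ g ∈ F, f ⊔ g ∈ F ∧ f ⊓ g ∈ F

/-- `F`, with the order induced from `E`, is Dedekind complete in its own right. -/
def IsDedekindCompleteSubspace (F : Submodule ℝ E) : Prop :=
  ∀ A : Set F, A.Nonempty → BddAbove A → ∃ s : F, IsLUB A s

/-- A conditional expectation operator. -/
structure IsConditionalExpectation (T : E →ₗ[ℝ] E) : Prop where
  positive : IsPositiveOp T
  orderContinuous : IsOrderContinuous T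
  projection : ∀ f, T (T f) = T f
  map_weakOrderUnit : ∀ u, IsWeakOrderUnit u → IsWeakOrderUnit (T u)
  range_rieszSubspace : IsRieszSubspace (LinearMap.range T)
  range_dedekindComplete : IsDedekindCompleteSubspace (LinearMap.range T)

/-- A band: a solid linear subspace closed under all suprema that exist in `E`. -/
structure IsBand (B : Submodule ℝ E) : Prop where
  solid : ∀ f ∈ B, ∀ g, |g| ≤ |f| → g ∈ B
  sup_mem : ∀ A : Set E, A ⊆ B → ∀ s, IsLUB A s → s ∈ B

/-- The band generated by `u`. -/
def bandGenerated (u : E) : Submodule ℝ E := sInf {B | IsBand B ∧ u ∈ B}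

/-- The Cesàro mean `(1/n) ∑_{k<n} S^k f`. -/
def cesaro (S : E →ₗ[ℝ] E) (f : E) (n : ℕ) : E :=
  (n : ℝ)⁻¹ • ∑ k ∈ Finset.range n, (S ^ k) f

end Riesz

section DedekindComplete

variable {E : Type*} [AddCommGroup E] [ConditionallyCompleteLattice E] [Module ℝ E]

/-- The band projection onto the band `B` of a Dedekind complete Riesz space: on positive `f` it
is `sup {g ∈ B | 0 ≤ g ≤ f}`, and `P f = P f⁺ - P f⁻` in general. -/
def bandProj (B : Submodule ℝ E) (f : E) : E :=
  sSup {g | g ∈ B ∧ 0 ≤ g ∧ g ≤ f⁺} - sSup {g | g ∈ B ∧ 0 ≤ g ∧ g ≤ f⁻}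

/-- `(E, T, S, e)` is a conditional expectation preserving system. -/
structure IsCEPS (T S : E →ₗ[ℝ] E) (e : E) : Prop where
  weakOrderUnit : IsWeakOrderUnit e
  condExp : IsConditionalExpectation T
  T_unit : T e = e
  rieszHom : IsRieszHom S
  orderContinuous : IsOrderContinuous S
  S_unit : S e = e
  T_comp_S : ∀ f, T (S f) = T f

/-- Conditional ergodicity, `L_S = T`: for every `f` the Cesàro means of `f` converge in order
to `T f`. (No `T`-universal completeness of `E` is required; if `E = L¹(T)`, this is
conditional ergodicity in the usual sense.) -/
def IsConditionallyErgodic (T S : E →ₗ[ℝ] E) : Prop :=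
  ∀ f, OrderTendsto (cesaro S f) (T f)

end DedekindComplete

end

end RieszErgodic

/-! This is a Rokhlin tower built without aperiodicity. The orbit of p is cut into disjoint levels:
`firstEntry S p k` is the part of S^k p not met by p, ..., S^(k-1) p. Each level lies below the
S-image of the previous one (`firstEntry_succ_le`), so T of the levels decreases from Tp. Their
supremum w (`saturation`) is S-invariant, so ergodicity gives Tw = w, and w turns out to be the band
projection of e (`IsCEPS.bandProj_eq_saturation`).

With n = m + 1, let r be the supremum of the levels of index m modulo n, and choose q with S^m q =
r. Since S reflects the order, S^i q lies below the levels of index i modulo n (`levelSup_add_le`).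
So the iterates are disjoint, and T of their supremum is at least n Tr. Since T decreases along the
levels, a block of n levels starting at an index m modulo n contributes at most n times T of its
first level. Only the m levels before the first block are left over, and they cost at most m Tp.
Hence w ≤ n Tr + m Tp (`map_sweep_add_mul_le`). -/

namespace RieszErgodic

/-! ### Disjointness and components in lattice-ordered groups. -/

section LatticeGroup

variable {E : Type*} [AddCommGroup E] [Lattice E]

lemma inf_eq_zero_of_le {a b a' b' : E} (h : a ⊓ b = 0) (ha : 0 ≤ a') (hb : 0 ≤ b')
    (haa : a' ≤ a) (hbb : b' ≤ b) : a' ⊓ b' = 0 :=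
  le_antisymm (h ▸ inf_le_inf haa hbb) (le_inf ha hb)

variable [IsOrderedAddMonoid E]

lemma add_le_of_inf_eq_zero {a b c : E} (h : a ⊓ b = 0) (ha : a ≤ c) (hb : b ≤ c) :
    a + b ≤ c := by
  rw [← inf_add_sup a b, h, zero_add]
  exact sup_le ha hb

/-- The element x = (a + b) ⊓ c is disjoint from a, so a + x ≤ a + b and x ≤ b ⊓ c. -/
lemma add_inf_eq_zero {a b c : E} (ha : 0 ≤ a) (hb : 0 ≤ b) (hc : 0 ≤ c) (hac : a ⊓ c = 0)
    (hbc : b ⊓ c = 0) : (a + b) ⊓ c = 0 := by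
  have hx : 0 ≤ (a + b) ⊓ c := le_inf (add_nonneg ha hb) hc
  have hax : a ⊓ ((a + b) ⊓ c) = 0 := inf_eq_zero_of_le hac ha hx le_rfl inf_le_right
  have h : a + (a + b) ⊓ c ≤ a + b :=
    add_le_of_inf_eq_zero hax (le_add_of_nonneg_right hb) inf_le_left
  refine le_antisymm ?_ hx
  rw [← hbc]
  exact le_inf (le_of_add_le_add_left h) inf_le_right

lemma nsmul_inf_eq_zero {a c : E} (ha : 0 ≤ a) (hc : 0 ≤ c) (hac : a ⊓ c = 0) (k : ℕ) :
    (k • a) ⊓ c = 0 := by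
  induction k with
  | zero => simpa using hc
  | succ k ih =>
    rw [succ_nsmul]
    exact add_inf_eq_zero (nsmul_nonneg ha k) ha hc ih hac

lemma sum_inf_eq_zero {ι : Type*} (s : Finset ι) {x : ι → E} {c : E} (hx : ∀ i ∈ s, 0 ≤ x i)
    (hc : 0 ≤ c) (h : ∀ i ∈ s, x i ⊓ c = 0) : (∑ i ∈ s, x i) ⊓ c = 0 :=
  (Finset.sum_induction x (fun y => 0 ≤ y ∧ y ⊓ c = 0)
    (fun _ _ ha hb => ⟨add_nonneg ha.1 hb.1, add_inf_eq_zero ha.1 hb.1 hc ha.2 hb.2⟩)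
    ⟨le_rfl, inf_eq_left.2 hc⟩ fun i hi => ⟨hx i hi, h i hi⟩).2

lemma sum_range_le_of_disjoint {x : ℕ → E} {M : E} (hM : 0 ≤ M) (N : ℕ)
    (hx : ∀ i < N, 0 ≤ x i) (hd : ∀ i < N, ∀ j < N, i ≠ j → x i ⊓ x j = 0)
    (hxM : ∀ i < N, x i ≤ M) : ∑ i ∈ Finset.range N, x i ≤ M := by
  induction N with
  | zero => simpa using hM
  | succ N ih =>
    rw [Finset.sum_range_succ]
    refine add_le_of_inf_eq_zero ?_ ?_ (hxM N N.lt_succ_self)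
    · refine sum_inf_eq_zero _ (fun i hi => hx i ?_) (hx N N.lt_succ_self) fun i hi => hd i ?_ N
        N.lt_succ_self ?_ <;> have := Finset.mem_range.1 hi <;> omega
    · exact ih (fun i hi => hx i (by omega)) (fun i hi j hj => hd i (by omega) j (by omega))
        fun i hi => hxM i (by omega)

/-- Disjointness from a positive element passes to suprema. -/
lemma inf_eq_zero_of_isLUB {A : Set E} {s c : E} (hA : IsLUB A s) (hs : 0 ≤ s) (hc : 0 ≤ c)
    (h : ∀ a ∈ A, a⁺ ⊓ c = 0) : s ⊓ c = 0 := by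
  have hd : 0 ≤ s ⊓ c := le_inf hs hc
  refine le_antisymm ?_ hd
  have : s ≤ s - s ⊓ c := hA.2 fun a ha => by
    rw [le_sub_iff_add_le]
    refine (add_le_add_left (le_posPart a) _).trans ?_
    exact add_le_of_inf_eq_zero (inf_eq_zero_of_le (h a ha) (posPart_nonneg a) hd le_rfl
      inf_le_right) (sup_le (hA.1 ha) hs) inf_le_left
  simpa using this

lemma inf_eq_zero_of_isLUB_of_nonneg {A : Set E} {s c : E} (hA : IsLUB A s) (hs : 0 ≤ s)
    (hc : 0 ≤ c) (hA0 : ∀ a ∈ A, 0 ≤ a) (h : ∀ a ∈ A, a ⊓ c = 0) : s ⊓ c = 0 :=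
  inf_eq_zero_of_isLUB hA hs hc fun a ha => by rw [posPart_of_nonneg (hA0 a ha)]; exact h a ha

lemma isComponent_of_isLUB {A : Set E} {s e : E} (hA : IsLUB A s) (hs : 0 ≤ s)
    (h : ∀ a ∈ A, IsComponent a e) : IsComponent s e := by
  have hse : s ≤ e := hA.2 fun a ha => (h a ha).2.1
  refine ⟨hs, hse, ?_⟩
  rw [inf_comm]
  refine inf_eq_zero_of_isLUB_of_nonneg hA hs (sub_nonneg.2 hse) (fun a ha => (h a ha).1)
    fun a ha => ?_
  exact inf_eq_zero_of_le ((inf_comm _ _).trans (h a ha).2.2) (h a ha).1 (sub_nonneg.2 hse)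
    le_rfl (sub_le_sub_left (hA.1 ha) e)

lemma IsComponent.sup {a b e : E} (ha : IsComponent a e) (hb : IsComponent b e) :
    IsComponent (a ⊔ b) e := by
  refine isComponent_of_isLUB (A := {a, b}) isLUB_pair (ha.1.trans le_sup_left) ?_
  rintro x (rfl | rfl)
  exacts [ha, hb]

lemma IsComponent.sub {a b e : E} (ha : IsComponent a e) (hb : IsComponent b e) (hab : a ≤ b) :
    IsComponent (b - a) e := by
  have h0 : 0 ≤ b - a := sub_nonneg.2 hab
  refine ⟨h0, (sub_le_self b ha.1).trans hb.2.1, ?_⟩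
  rw [show e - (b - a) = (e - b) + a by abel]
  refine add_inf_eq_zero (sub_nonneg.2 hb.2.1) ha.1 h0 ?_ ?_
  · exact inf_eq_zero_of_le hb.2.2 (sub_nonneg.2 hb.2.1) h0 le_rfl (sub_le_self b ha.1)
  · exact inf_eq_zero_of_le ((inf_comm _ _).trans ha.2.2) ha.1 h0 le_rfl
      (sub_le_sub_right hb.2.1 a)

lemma IsComponent.of_le {a b e : E} (ha : IsComponent a e) (hab : a ≤ b) (hb : b ≤ e) :
    IsComponent a b :=
  ⟨ha.1, hab, inf_eq_zero_of_le ha.2.2 (sub_nonneg.2 hab) ha.1 (sub_le_sub_right hb a) le_rfl⟩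

lemma sup_sub_sup_le {a b c : E} (hcb : c ≤ b) : a ⊔ b - a ⊔ c ≤ b - c := by
  rw [sub_le_iff_le_add]
  refine sup_le ?_ ?_
  · exact le_sup_left.trans (le_add_of_nonneg_left (sub_nonneg.2 hcb))
  · calc b = b - c + c := by abel
      _ ≤ _ := by gcongr; exact le_sup_right

lemma rieszDisjoint_of_nonneg {a b : E} (ha : 0 ≤ a) (hb : 0 ≤ b) (h : a ⊓ b = 0) :
    RieszDisjoint a b := by
  rwa [RieszDisjoint, abs_of_nonneg ha, abs_of_nonneg hb]

section Module

variable [Module ℝ E] [IsOrderedModule ℝ E]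

/-- Trades real multiples for natural ones, to which `nsmul_inf_eq_zero` applies. -/
lemma abs_smul_le_nsmul (r : ℝ) (f : E) : |r • f| ≤ ⌈|r|⌉₊ • |f| := by
  have key : ∀ g : E, g ≤ |f| → -g ≤ |f| → r • g ≤ ⌈|r|⌉₊ • |f| := fun g h1 h2 => by
    have h3 : |r| • |f| ≤ ⌈|r|⌉₊ • |f| := by
      rw [← Nat.cast_smul_eq_nsmul ℝ]
      exact smul_le_smul_of_nonneg_right (Nat.le_ceil _) (abs_nonneg f)
    refine le_trans ?_ h3
    rcases abs_cases r with ⟨h, -⟩ | ⟨h, -⟩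
    · conv_lhs => rw [← h]
      exact smul_le_smul_of_nonneg_left h1 (abs_nonneg r)
    · have : r • g = |r| • (-g) := by rw [h]; simp
      rw [this]
      exact smul_le_smul_of_nonneg_left h2 (abs_nonneg r)
  refine sup_le (key f (le_abs_self f) (neg_le_abs f)) ?_
  rw [← smul_neg]
  exact key (-f) (neg_le_abs f) (by simpa using le_abs_self f)

/-- The disjoint complement of a positive element, as a subspace. -/
def disjointComplement (c : E) (hc : 0 ≤ c) : Submodule ℝ E where
  carrier := {f | |f| ⊓ c = 0}
  zero_mem' := by simpa using hc
  add_mem' {f g} hf hg :=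
    inf_eq_zero_of_le (add_inf_eq_zero (abs_nonneg f) (abs_nonneg g) hc hf hg) (abs_nonneg _) hc
      (abs_add_le f g) le_rfl
  smul_mem' r f hf :=
    inf_eq_zero_of_le (nsmul_inf_eq_zero (abs_nonneg f) hc hf ⌈|r|⌉₊) (abs_nonneg _) hc
      (abs_smul_le_nsmul r f) le_rfl

lemma mem_disjointComplement {c : E} (hc : 0 ≤ c) {f : E} :
    f ∈ disjointComplement c hc ↔ |f| ⊓ c = 0 := Iff.rfl

lemma isBand_disjointComplement (c : E) (hc : 0 ≤ c) : IsBand (disjointComplement c hc) where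
  solid f hf g hg := inf_eq_zero_of_le hf (abs_nonneg g) hc hg le_rfl
  sup_mem A hA s hs := by
    rw [mem_disjointComplement]
    rcases A.eq_empty_or_nonempty with rfl | ⟨a, ha⟩
    -- A supremum of the empty set is a least element, which forces c ≤ 0.
    · have hbot : ∀ x, s ≤ x := fun x => hs.2 (by simp)
      have h1 : c ≤ 0 := by simpa using hbot (s - c)
      exact le_antisymm (inf_le_right.trans h1) (le_inf (abs_nonneg s) hc)
    · have hpos : ∀ b ∈ A, b⁺ ⊓ c = 0 := fun b hb =>
        inf_eq_zero_of_le (hA hb) (posPart_nonneg b) hc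
          (sup_le (le_abs_self b) (abs_nonneg b)) le_rfl
      have hLUB : IsLUB ((·⁺) '' A) s⁺ := by
        refine ⟨?_, fun u hu => ?_⟩
        · rintro _ ⟨b, hb, rfl⟩
          exact sup_le_sup_right (hs.1 hb) 0
        · exact sup_le (hs.2 fun b hb => (le_posPart b).trans (hu ⟨b, hb, rfl⟩))
            ((posPart_nonneg a).trans (hu ⟨a, ha, rfl⟩))
      have h1 : s⁺ ⊓ c = 0 := by
        refine inf_eq_zero_of_isLUB_of_nonneg hLUB (posPart_nonneg s) hc ?_ ?_
        · rintro _ ⟨b, -, rfl⟩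
          exact posPart_nonneg b
        · rintro _ ⟨b, hb, rfl⟩
          exact hpos b hb
      have h2 : s⁻ ⊓ c = 0 :=
        inf_eq_zero_of_le (hA ha) (negPart_nonneg s) hc
          (sup_le ((neg_le_neg (hs.1 ha)).trans (neg_le_abs a)) (abs_nonneg a)) le_rfl
      rw [← posPart_add_negPart s]
      exact add_inf_eq_zero (posPart_nonneg s) (negPart_nonneg s) hc h1 h2

end Module

end LatticeGroup

/-! ### Positive operators, Riesz homomorphisms and the levels of the orbit. -/

section Operators

set_option linter.unusedSectionVars false

variable {E : Type*} [AddCommGroup E] [Lattice E] [IsOrderedAddMonoid E] [Module ℝ E]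

lemma IsPositiveOp.mono {T : E →ₗ[ℝ] E} (hT : IsPositiveOp T) {f g : E} (h : f ≤ g) :
    T f ≤ T g := by
  have := hT (g - f) (sub_nonneg.2 h)
  rwa [map_sub, sub_nonneg] at this

lemma IsRieszHom.isPositiveOp {S : E →ₗ[ℝ] E} (hS : IsRieszHom S) : IsPositiveOp S := by
  intro f hf
  have := (hS f 0).1
  rw [sup_eq_left.2 hf, map_zero] at this
  exact this ▸ le_sup_right

lemma IsRieszHom.pow {S : E →ₗ[ℝ] E} (hS : IsRieszHom S) (m : ℕ) : IsRieszHom (S ^ m) := by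
  induction m with
  | zero => intro f g; simp
  | succ m ih =>
    intro f g
    simp only [pow_succ, Module.End.mul_apply, (hS f g).1, (hS f g).2]
    exact ih _ _

lemma IsRieszHom.isComponent {S : E →ₗ[ℝ] E} (hS : IsRieszHom S) {a e : E}
    (ha : IsComponent a e) : IsComponent (S a) (S e) := by
  refine ⟨hS.isPositiveOp a ha.1, hS.isPositiveOp.mono ha.2.1, ?_⟩
  rw [← map_sub, ← (hS _ _).2, ha.2.2, map_zero]

lemma IsOrderContinuous.isLUB_map {T : E →ₗ[ℝ] E} (hT : IsOrderContinuous T) {x : ℕ → E}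
    (hx : Monotone x) {s : E} (hs : IsLUB (Set.range x) s) :
    IsLUB (Set.range fun k => T (x k)) (T s) := by
  have h := hT (Set.range fun k => s - x k) (Set.range_nonempty _) ?_ ?_
  · refine ⟨?_, fun u hu => ?_⟩
    · rintro _ ⟨k, rfl⟩
      have := h.1 ⟨s - x k, ⟨k, rfl⟩, rfl⟩
      rwa [map_sub, sub_nonneg] at this
    · have : T s - u ≤ 0 := h.2 <| by
        rintro _ ⟨_, ⟨k, rfl⟩, rfl⟩
        rw [map_sub]
        exact sub_le_sub_left (hu ⟨k, rfl⟩) _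
      simpa using this
  · rintro _ ⟨i, rfl⟩ _ ⟨j, rfl⟩
    exact ⟨_, ⟨max i j, rfl⟩, sub_le_sub_left (hx (le_max_left i j)) s,
      sub_le_sub_left (hx (le_max_right i j)) s⟩
  · refine ⟨?_, fun u hu => ?_⟩
    · rintro _ ⟨k, rfl⟩
      exact sub_nonneg.2 (hs.1 ⟨k, rfl⟩)
    · have : s ≤ s - u := hs.2 <| by
        rintro _ ⟨k, rfl⟩
        exact le_sub_comm.1 (hu ⟨k, rfl⟩)
      simpa using this

lemma OrderTendsto.eq_of_eventually_const {x : ℕ → E} {l a : E} (h : OrderTendsto x l)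
    (hx : ∀ m ≥ 1, x m = a) : l = a := by
  obtain ⟨y, hy, hy0, hxy⟩ := h
  have : |a - l| ≤ 0 := hy0.2 <| by
    rintro _ ⟨k, rfl⟩
    -- The index is shifted because nothing is known about x at 0.
    have := hxy (k + 1)
    rw [hx _ (by omega)] at this
    exact this.trans (hy k.le_succ)
  refine le_antisymm (sub_nonpos.1 ?_) (sub_nonpos.1 ((le_abs_self _).trans this))
  rw [← neg_sub]
  exact (neg_le_abs _).trans this

lemma iterate_apply_eq_self {S : E →ₗ[ℝ] E} {f : E} (hf : S f = f) (m : ℕ) : (S ^ m) f = f := by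
  rw [Module.End.pow_apply]
  exact Function.iterate_fixed hf m

lemma apply_iterate_eq {T S : E →ₗ[ℝ] E} (h : ∀ f, T (S f) = T f) (m : ℕ) (f : E) :
    T ((S ^ m) f) = T f := by
  induction m with
  | zero => simp
  | succ m ih => rw [pow_succ', Module.End.mul_apply, h, ih]

lemma cesaro_of_fixed {S : E →ₗ[ℝ] E} {f : E} (hf : S f = f) {m : ℕ} (hm : 1 ≤ m) :
    cesaro S f m = f := by
  have hm' : (m : ℝ) ≠ 0 := by positivity
  simp only [cesaro, iterate_apply_eq_self hf, Finset.sum_const, Finset.card_range]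
  rw [← Nat.cast_smul_eq_nsmul ℝ, smul_smul, inv_mul_cancel₀ hm', one_smul]

/-- A Riesz homomorphism preserving a strictly positive operator reflects the order. -/
lemma IsRieszHom.le_of_map_le {T S : E →ₗ[ℝ] E} (hS : IsRieszHom S)
    (hT : IsStrictlyPositiveOp T) (hTS : ∀ f, T (S f) = T f) {f g : E} (h : S f ≤ S g) :
    f ≤ g := by
  have h1 : S ((f - g) ⊔ 0) = 0 := by
    rw [(hS _ _).1, map_zero, map_sub]
    exact sup_eq_right.2 (sub_nonpos.2 h)
  have h2 : (f - g) ⊔ 0 = 0 := hT.2 _ le_sup_right (by rw [← hTS, h1, map_zero])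
  exact sub_nonpos.1 (sup_eq_right.1 h2)

/-- `sweep S p k` is the supremum of `S ^ j p` over `j < k`. -/
def sweep (S : E →ₗ[ℝ] E) (p : E) : ℕ → E
  | 0 => 0
  | k + 1 => p ⊔ S (sweep S p k)

/-- The part of `S ^ k p` disjoint from all `S ^ j p` with `j < k`. -/
def firstEntry (S : E →ₗ[ℝ] E) (p : E) (k : ℕ) : E := sweep S p (k + 1) - sweep S p k

section Sweep

variable {S : E →ₗ[ℝ] E} {p e : E}

lemma sweep_isComponent (hS : IsRieszHom S) (hSe : S e = e) (hp : IsComponent p e) (k : ℕ) :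
    IsComponent (sweep S p k) e := by
  induction k with
  | zero =>
    have he : 0 ≤ e := hp.1.trans hp.2.1
    exact ⟨le_rfl, he, by simpa [sweep] using he⟩
  | succ k ih => exact hp.sup (hSe ▸ hS.isComponent ih)

lemma sweep_monotone (hS : IsRieszHom S) (hp : 0 ≤ p) : Monotone (sweep S p) := by
  refine monotone_nat_of_le_succ fun k => ?_
  induction k with
  | zero => exact hp.trans le_sup_left
  | succ k ih => exact sup_le_sup_left (hS.isPositiveOp.mono ih) p

lemma firstEntry_zero (hp : 0 ≤ p) : firstEntry S p 0 = p := by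
  simpa [firstEntry, sweep] using hp

lemma firstEntry_isComponent (hS : IsRieszHom S) (hSe : S e = e) (hp : IsComponent p e) (k : ℕ) :
    IsComponent (firstEntry S p k) e :=
  (sweep_isComponent hS hSe hp k).sub (sweep_isComponent hS hSe hp (k + 1))
    (sweep_monotone hS hp.1 k.le_succ)

lemma firstEntry_inf_of_lt (hS : IsRieszHom S) (hSe : S e = e) (hp : IsComponent p e) {i j : ℕ}
    (hij : i < j) : firstEntry S p i ⊓ firstEntry S p j = 0 := by
  have hi := sweep_isComponent hS hSe hp (i + 1)
  refine inf_eq_zero_of_le ((inf_comm _ _).trans hi.2.2) (firstEntry_isComponent hS hSe hp i).1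
    (firstEntry_isComponent hS hSe hp j).1 (sub_le_self _ (sweep_isComponent hS hSe hp i).1) ?_
  exact sub_le_sub (sweep_isComponent hS hSe hp (j + 1)).2.1 (sweep_monotone hS hp.1 hij)

lemma firstEntry_inf_of_ne (hS : IsRieszHom S) (hSe : S e = e) (hp : IsComponent p e) {i j : ℕ}
    (hij : i ≠ j) : firstEntry S p i ⊓ firstEntry S p j = 0 := by
  rcases hij.lt_or_gt with h | h
  · exact firstEntry_inf_of_lt hS hSe hp h
  · rw [inf_comm]
    exact firstEntry_inf_of_lt hS hSe hp h

/-- Both sweeps are p ⊔ S(·), and joining with p can only shrink a difference. -/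
lemma firstEntry_succ_le (hS : IsRieszHom S) (hp : 0 ≤ p) (k : ℕ) :
    firstEntry S p (k + 1) ≤ S (firstEntry S p k) := by
  rw [firstEntry, firstEntry, map_sub]
  exact sup_sub_sup_le (hS.isPositiveOp.mono (sweep_monotone hS hp k.le_succ))

lemma firstEntry_add_le (hS : IsRieszHom S) (hp : 0 ≤ p) (k m : ℕ) :
    firstEntry S p (k + m) ≤ (S ^ m) (firstEntry S p k) := by
  induction m with
  | zero => simp
  | succ m ih =>
    rw [pow_succ', Module.End.mul_apply]
    exact (firstEntry_succ_le hS hp (k + m)).trans (hS.isPositiveOp.mono ih)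

lemma sum_firstEntry (k : ℕ) : ∑ i ∈ Finset.range k, firstEntry S p i = sweep S p k := by
  simp only [firstEntry]
  rw [Finset.sum_range_sub (sweep S p)]
  simp [sweep]

variable {T : E →ₗ[ℝ] E}

lemma map_firstEntry_antitone (hS : IsRieszHom S) (hp : 0 ≤ p) (hT : IsPositiveOp T)
    (hTS : ∀ f, T (S f) = T f) : Antitone fun k => T (firstEntry S p k) :=
  antitone_nat_of_succ_le fun k => (hT.mono (firstEntry_succ_le hS hp k)).trans_eq (hTS _)

lemma map_sweep_le (hS : IsRieszHom S) (hp : 0 ≤ p) (hT : IsPositiveOp T)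
    (hTS : ∀ f, T (S f) = T f) (k : ℕ) : T (sweep S p k) ≤ k • T p := by
  rw [← sum_firstEntry, map_sum]
  refine (Finset.sum_le_card_nsmul _ _ (T p) fun i _ => ?_).trans_eq (by simp)
  have := map_firstEntry_antitone hS hp hT hTS i.zero_le
  simpa [firstEntry_zero hp] using this

/-- Bound of a swept block by the levels whose index is `n - 1` modulo `n`. -/
lemma map_sweep_add_mul_le (hS : IsRieszHom S) (hp : 0 ≤ p) (hT : IsPositiveOp T)
    (hTS : ∀ f, T (S f) = T f) (m N : ℕ) :
    T (sweep S p (m + N * (m + 1))) ≤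
      (m + 1) • (∑ j ∈ Finset.range N, T (firstEntry S p (j * (m + 1) + m))) + m • T p := by
  induction N with
  | zero => simpa using map_sweep_le hS hp hT hTS m
  | succ N ih =>
    have h : sweep S p (m + (N + 1) * (m + 1)) = sweep S p (m + N * (m + 1)) +
        ∑ i ∈ Finset.range (m + 1), firstEntry S p (m + N * (m + 1) + i) := by
      rw [← sum_firstEntry, ← sum_firstEntry, ← Finset.sum_range_add]
      congr 2
      ring
    -- The first level of the block has the largest image under T.
    have h2 : ∑ i ∈ Finset.range (m + 1), T (firstEntry S p (m + N * (m + 1) + i)) ≤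
        (m + 1) • T (firstEntry S p (N * (m + 1) + m)) := by
      refine (Finset.sum_le_card_nsmul _ _ _ fun i _ => ?_).trans_eq
        (by rw [Finset.card_range])
      exact map_firstEntry_antitone hS hp hT hTS (by omega)
    rw [h, map_add, map_sum, Finset.sum_range_succ _ N, smul_add]
    refine (add_le_add ih h2).trans_eq ?_
    abel

end Sweep

end Operators

/-! ### Saturation, residue classes of levels, and the band generated by Tp. -/

section DedekindComplete

variable {E : Type*} [AddCommGroup E] [ConditionallyCompleteLattice E] [IsOrderedAddMonoid E]
  [Module ℝ E]

/-- The saturation `⋁ k, S ^ k p`. -/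
noncomputable def saturation (S : E →ₗ[ℝ] E) (p : E) : E := ⨆ k, sweep S p k

/-- The supremum of the levels `firstEntry S p k` with `k` congruent to `i` modulo `n`. -/
noncomputable def levelSup (S : E →ₗ[ℝ] E) (p : E) (n i : ℕ) : E :=
  ⨆ j : ℕ, firstEntry S p (j * n + i)

section RieszHom

variable {S : E →ₗ[ℝ] E} {p e : E}

lemma isLUB_saturation (hS : IsRieszHom S) (hSe : S e = e) (hp : IsComponent p e) :
    IsLUB (Set.range (sweep S p)) (saturation S p) :=
  isLUB_ciSup ⟨e, by rintro _ ⟨k, rfl⟩; exact (sweep_isComponent hS hSe hp k).2.1⟩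

lemma saturation_isComponent (hS : IsRieszHom S) (hSe : S e = e) (hp : IsComponent p e) :
    IsComponent (saturation S p) e := by
  have h := isLUB_saturation hS hSe hp
  refine isComponent_of_isLUB h (h.1 ⟨0, rfl⟩) ?_
  rintro _ ⟨k, rfl⟩
  exact sweep_isComponent hS hSe hp k

lemma isLUB_levelSup (hS : IsRieszHom S) (hSe : S e = e) (hp : IsComponent p e) (n i : ℕ) :
    IsLUB (Set.range fun j => firstEntry S p (j * n + i)) (levelSup S p n i) :=
  isLUB_ciSup ⟨e, by rintro _ ⟨k, rfl⟩; exact (firstEntry_isComponent hS hSe hp _).2.1⟩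

lemma levelSup_nonneg (hS : IsRieszHom S) (hSe : S e = e) (hp : IsComponent p e) (n i : ℕ) :
    0 ≤ levelSup S p n i :=
  (firstEntry_isComponent hS hSe hp _).1.trans ((isLUB_levelSup hS hSe hp n i).1 ⟨0, rfl⟩)

lemma levelSup_isComponent (hS : IsRieszHom S) (hSe : S e = e) (hp : IsComponent p e)
    (n i : ℕ) : IsComponent (levelSup S p n i) e := by
  refine isComponent_of_isLUB (isLUB_levelSup hS hSe hp n i) (levelSup_nonneg hS hSe hp n i) ?_
  rintro _ ⟨k, rfl⟩
  exact firstEntry_isComponent hS hSe hp _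

lemma levelSup_inf (hS : IsRieszHom S) (hSe : S e = e) (hp : IsComponent p e) {n i j : ℕ}
    (hi : i < n) (hj : j < n) (hij : i ≠ j) : levelSup S p n i ⊓ levelSup S p n j = 0 := by
  refine inf_eq_zero_of_isLUB_of_nonneg (isLUB_levelSup hS hSe hp n i)
    (levelSup_nonneg hS hSe hp n i) (levelSup_nonneg hS hSe hp n j) ?_ ?_
  · rintro _ ⟨k, rfl⟩
    exact (firstEntry_isComponent hS hSe hp _).1
  rintro _ ⟨k, rfl⟩
  have hk := (firstEntry_isComponent hS hSe hp (k * n + i)).1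
  rw [inf_comm]
  refine inf_eq_zero_of_isLUB_of_nonneg (isLUB_levelSup hS hSe hp n j)
    (levelSup_nonneg hS hSe hp n j) hk ?_ ?_
  · rintro _ ⟨l, rfl⟩
    exact (firstEntry_isComponent hS hSe hp _).1
  rintro _ ⟨l, rfl⟩
  refine firstEntry_inf_of_ne hS hSe hp fun h => hij ?_
  have := congrArg (· % n) h
  simpa [Nat.mul_add_mod', Nat.mod_eq_of_lt hi, Nat.mod_eq_of_lt hj, eq_comm] using this

lemma levelSup_add_le (hS : IsRieszHom S) (hSe : S e = e) (hp : IsComponent p e) (n i m : ℕ) :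
    levelSup S p n (i + m) ≤ (S ^ m) (levelSup S p n i) := by
  refine (isLUB_levelSup hS hSe hp n (i + m)).2 ?_
  rintro _ ⟨j, rfl⟩
  dsimp only
  rw [← add_assoc]
  exact (firstEntry_add_le hS hp.1 _ m).trans
    ((hS.pow m).isPositiveOp.mono ((isLUB_levelSup hS hSe hp n i).1 ⟨j, rfl⟩))

lemma levelSup_le_saturation (hS : IsRieszHom S) (hSe : S e = e) (hp : IsComponent p e)
    (n i : ℕ) : levelSup S p n i ≤ saturation S p := by
  refine (isLUB_levelSup hS hSe hp n i).2 ?_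
  rintro _ ⟨j, rfl⟩
  exact (sub_le_self _ (sweep_isComponent hS hSe hp _).1).trans
    ((isLUB_saturation hS hSe hp).1 ⟨_, rfl⟩)

end RieszHom

section System

variable {T S : E →ₗ[ℝ] E} {e p : E}

/-- Shifting the sweeps gives Sw ≤ w; T kills w - Sw, so strict positivity gives equality. -/
lemma IsCEPS.map_saturation (hsys : IsCEPS T S e) (hT : IsStrictlyPositiveOp T)
    (hp : IsComponent p e) : S (saturation S p) = saturation S p := by
  have hw := isLUB_saturation hsys.rieszHom hsys.S_unit hp
  have hSw := hsys.orderContinuous.isLUB_map (sweep_monotone hsys.rieszHom hp.1) hw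
  have hle : S (saturation S p) ≤ saturation S p := hSw.2 <| by
    rintro _ ⟨k, rfl⟩
    exact le_sup_right.trans (hw.1 ⟨k + 1, rfl⟩)
  have h0 := hT.2 _ (sub_nonneg.2 hle) (by rw [map_sub, hsys.T_comp_S, sub_self])
  exact (sub_eq_zero.1 h0).symm

lemma IsCEPS.condExp_saturation (hsys : IsCEPS T S e) (hT : IsStrictlyPositiveOp T)
    (herg : IsConditionallyErgodic T S) (hp : IsComponent p e) :
    T (saturation S p) = saturation S p :=
  (herg _).eq_of_eventually_const fun _ hm => cesaro_of_fixed (hsys.map_saturation hT hp) hm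

/-- A positive element whose conditional expectation is disjoint from the invariant element
`c` is itself disjoint from `c`. -/
lemma IsStrictlyPositiveOp.inf_eq_zero (hT : IsStrictlyPositiveOp T) {f c : E} (hf : 0 ≤ f)
    (hc : 0 ≤ c) (hTc : T c = c) (h : T f ⊓ c = 0) : f ⊓ c = 0 := by
  have h0 := le_inf hf hc
  refine hT.2 _ h0 (le_antisymm ?_ (hT.1 _ h0))
  rw [← h]
  exact le_inf (hT.1.mono inf_le_left) ((hT.1.mono inf_le_right).trans_eq hTc)

/-- With v the right-hand side, e - v is T-invariant and disjoint from Tp, hence from every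
T(sweep), hence from every sweep. -/
lemma IsCEPS.saturation_le_iSup (hsys : IsCEPS T S e) (hT : IsStrictlyPositiveOp T)
    (hp : IsComponent p e) : saturation S p ≤ ⨆ k : ℕ, e ⊓ k • T p := by
  have he : 0 ≤ e := hp.1.trans hp.2.1
  have hTp : 0 ≤ T p := hT.1 p hp.1
  set x : ℕ → E := fun k => e ⊓ k • T p with hx
  have hv : IsLUB (Set.range x) (⨆ k, x k) :=
    isLUB_ciSup ⟨e, by rintro _ ⟨k, rfl⟩; exact inf_le_left⟩
  set v := ⨆ k, x k
  have hxm : Monotone x := fun i j hij => inf_le_inf_left e (nsmul_le_nsmul_left hTp hij)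
  -- The range of T is a sublattice containing e and Tp.
  have hTx : ∀ k, T (x k) = x k := fun k => by
    have hmem : x k ∈ LinearMap.range T :=
      (hsys.condExp.range_rieszSubspace e ⟨e, hsys.T_unit⟩ (k • T p)
        ⟨k • p, map_nsmul T k p⟩).2
    obtain ⟨y, hy⟩ := hmem
    rw [← hy, hsys.condExp.projection]
  have hTv : T v = v := by
    have := hsys.condExp.orderContinuous.isLUB_map hxm hv
    simp only [hTx] at this
    exact this.unique hv
  have hve : v ≤ e := hv.2 (by rintro _ ⟨k, rfl⟩; exact inf_le_left)
  have hv0 : 0 ≤ v := (le_inf he (nsmul_nonneg hTp 0)).trans (hv.1 ⟨0, rfl⟩)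
  have hc : 0 ≤ e - v := sub_nonneg.2 hve
  have hdisj : T p ⊓ (e - v) = 0 := by
    refine le_antisymm ?_ (le_inf hTp hc)
    -- Adding Tp ⊓ (e - v) to x k keeps it below x (k + 1), hence below v.
    have : v ≤ v - T p ⊓ (e - v) := hv.2 <| by
      rintro _ ⟨k, rfl⟩
      rw [le_sub_iff_add_le]
      refine le_trans ?_ (hv.1 ⟨k + 1, rfl⟩)
      refine le_inf ?_ ?_
      · calc x k + T p ⊓ (e - v) ≤ v + (e - v) := add_le_add (hv.1 ⟨k, rfl⟩) inf_le_right
          _ = e := by abel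
      · rw [succ_nsmul]
        exact add_le_add inf_le_right inf_le_left
    simpa using this
  refine (isLUB_saturation hsys.rieszHom hsys.S_unit hp).2 ?_
  rintro _ ⟨k, rfl⟩
  have hk := sweep_isComponent hsys.rieszHom hsys.S_unit hp k
  have h1 : T (sweep S p k) ⊓ (e - v) = 0 :=
    inf_eq_zero_of_le (nsmul_inf_eq_zero hTp hc hdisj k) (hT.1 _ hk.1) hc
      (map_sweep_le hsys.rieszHom hp.1 hT.1 hsys.T_comp_S k) le_rfl
  have h2 := hT.inf_eq_zero hk.1 hc (by rw [map_sub, hsys.T_unit, hTv]) h1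
  have h3 := add_le_of_inf_eq_zero h2 hk.2.1 (sub_le_self e hv0)
  rw [← le_sub_iff_add_le] at h3
  simpa using h3

variable [IsOrderedModule ℝ E]

/-- Under conditional ergodicity the saturation of `p` is the band projection of `e` onto the
band generated by `T p`. -/
lemma IsCEPS.bandProj_eq_saturation (hsys : IsCEPS T S e) (hT : IsStrictlyPositiveOp T)
    (herg : IsConditionallyErgodic T S) (hp : IsComponent p e) :
    bandProj (bandGenerated (T p)) e = saturation S p := by
  have he : 0 ≤ e := hp.1.trans hp.2.1
  have hTp : 0 ≤ T p := hT.1 p hp.1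
  have hw := isLUB_saturation hsys.rieszHom hsys.S_unit hp
  have hwc := saturation_isComponent hsys.rieszHom hsys.S_unit hp
  have hzero : {g | g ∈ bandGenerated (T p) ∧ 0 ≤ g ∧ g ≤ e⁻} = {0} := by
    ext g
    simp only [negPart_eq_zero.2 he, Set.mem_ofPred_eq, Set.mem_singleton_iff]
    exact ⟨fun h => le_antisymm h.2.2 h.2.1, by rintro rfl; exact ⟨zero_mem _, le_rfl, le_rfl⟩⟩
  rw [bandProj, hzero, csSup_singleton, sub_zero, posPart_of_nonneg he]
  have hne : (0 : E) ∈ {g | g ∈ bandGenerated (T p) ∧ 0 ≤ g ∧ g ≤ e} :=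
    ⟨zero_mem _, le_rfl, he⟩
  refine le_antisymm (csSup_le ⟨0, hne⟩ ?_) ?_
  · rintro g ⟨hgB, hg0, hge⟩
    have hc : 0 ≤ e - saturation S p := sub_nonneg.2 hwc.2.1
    have hpw : p ≤ saturation S p := (firstEntry_zero (S := S) hp.1).ge.trans
      ((sub_le_self _ le_rfl).trans (hw.1 ⟨1, rfl⟩))
    have hTpw : T p ≤ saturation S p :=
      (hT.1.mono hpw).trans_eq (hsys.condExp_saturation hT herg hp)
    -- The disjoint complement of e - w is a band containing Tp, so it contains the generated band.
    have hmem : T p ∈ disjointComplement _ hc := by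
      rw [mem_disjointComplement, abs_of_nonneg hTp]
      exact inf_eq_zero_of_le ((inf_comm _ _).trans hwc.2.2) hTp hc hTpw le_rfl
    have hg : g ∈ disjointComplement _ hc :=
      (Submodule.mem_sInf.1 hgB) _ ⟨isBand_disjointComplement _ hc, hmem⟩
    rw [mem_disjointComplement, abs_of_nonneg hg0] at hg
    have h3 := add_le_of_inf_eq_zero hg hge (sub_le_self e hwc.1)
    rw [← le_sub_iff_add_le] at h3
    simpa using h3
  · refine (hsys.saturation_le_iSup hT hp).trans
      (le_csSup ⟨e, fun g hg => hg.2.2⟩ ⟨?_, ?_, ?_⟩)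
    · refine Submodule.mem_sInf.2 fun B hB => hB.1.sup_mem (Set.range fun k : ℕ => e ⊓ k • T p) ?_ _
        (isLUB_ciSup ⟨e, by rintro _ ⟨k, rfl⟩; exact inf_le_left⟩)
      rintro _ ⟨k, rfl⟩
      refine hB.1.solid (k • T p) (nsmul_mem hB.2 k) _ ?_
      have hk := nsmul_nonneg hTp k
      rw [abs_of_nonneg (le_inf he hk), abs_of_nonneg hk]
      exact inf_le_right
    · exact hwc.1.trans (hsys.saturation_le_iSup hT hp)
    · exact ciSup_le fun k => inf_le_left

end System

end DedekindComplete

end RieszErgodic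

/-! ### The tower and its size. -/

open RieszErgodic in
theorem mainTheorem2 {E : Type*} [AddCommGroup E] [ConditionallyCompleteLattice E]
    [IsOrderedAddMonoid E] [Module ℝ E] [IsOrderedModule ℝ E]
    (T S : E →ₗ[ℝ] E) (e : E)
    (hsys : IsCEPS T S e) (hT : IsStrictlyPositiveOp T)
    (herg : IsConditionallyErgodic T S) (hS : Function.Surjective S)
    (n : ℕ) (hn : 1 ≤ n) (p : E) (hp : IsComponent p e) :
    ∃ q : E, IsComponent q (bandProj (bandGenerated (T p)) e) ∧
      (∀ i < n, ∀ j < n, i ≠ j → RieszDisjoint ((S ^ i) q) ((S ^ j) q)) ∧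
      (bandProj (bandGenerated (T p)) e - ((n : ℝ) - 1) • T p)⁺ ≤
        T (⨆ j : Fin n, (S ^ (j : ℕ)) q) := by
  have hR := hsys.rieszHom
  have hSe := hsys.S_unit
  have hTS := hsys.T_comp_S
  rw [hsys.bandProj_eq_saturation hT herg hp]
  obtain ⟨m, rfl⟩ : ∃ m, n = m + 1 := ⟨n - 1, by omega⟩
  have hSm : Function.Surjective (S ^ m) := by
    rw [Module.End.coe_pow]
    exact hS.iterate m
  -- The top floor of the tower is prescribed and pulled back m steps to its base.
  obtain ⟨q, hq⟩ := hSm (levelSup S p (m + 1) m)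
  have hr := levelSup_isComponent hR hSe hp (m + 1) m
  have hrw := hr.of_le (levelSup_le_saturation hR hSe hp (m + 1) m)
    (saturation_isComponent hR hSe hp).2.1
  have hreflect : ∀ k {f g : E}, (S ^ k) f ≤ (S ^ k) g → f ≤ g := fun k f g h =>
    (hR.pow k).le_of_map_le hT (apply_iterate_eq hTS k) h
  have hSw := iterate_apply_eq_self (hsys.map_saturation hT hp) m
  have hq0 : 0 ≤ q := hreflect m (by rw [map_zero, hq]; exact hr.1)
  have hqw : q ≤ saturation S p := hreflect m (by rw [hSw, hq]; exact hrw.2.1)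
  have hSq0 : ∀ i, 0 ≤ (S ^ i) q := fun i => (hR.pow i).isPositiveOp q hq0
  have hlevel : ∀ i < m + 1, (S ^ i) q ≤ levelSup S p (m + 1) i := fun i hi => by
    refine hreflect (m - i) ?_
    rw [← Module.End.mul_apply, ← pow_add, Nat.sub_add_cancel (by omega), hq]
    have := levelSup_add_le hR hSe hp (m + 1) i (m - i)
    rwa [Nat.add_sub_cancel' (by omega)] at this
  have hdisj : ∀ i < m + 1, ∀ j < m + 1, i ≠ j → (S ^ i) q ⊓ (S ^ j) q = 0 :=
    fun i hi j hj hij => inf_eq_zero_of_le (levelSup_inf hR hSe hp hi hj hij) (hSq0 i) (hSq0 j)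
      (hlevel i hi) (hlevel j hj)
  refine ⟨q, ⟨hq0, hqw, ?_⟩, fun i hi j hj hij =>
    rieszDisjoint_of_nonneg (hSq0 i) (hSq0 j) (hdisj i hi j hj hij), ?_⟩
  · have h0 : 0 ≤ (saturation S p - q) ⊓ q := le_inf (sub_nonneg.2 hqw) hq0
    refine le_antisymm (hreflect m ?_) h0
    rw [((hR.pow m) _ _).2, map_sub, hSw, hq, map_zero]
    exact hrw.2.2.le
  set M := ⨆ j : Fin (m + 1), (S ^ (j : ℕ)) q
  have hSM : ∀ i < m + 1, (S ^ i) q ≤ M := fun i hi =>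
    le_ciSup (f := fun j : Fin (m + 1) => (S ^ (j : ℕ)) q) (Set.finite_range _).bddAbove ⟨i, hi⟩
  have hM : 0 ≤ M := (hSq0 0).trans (hSM 0 m.succ_pos)
  refine sup_le ?_ (hT.1 M hM)
  have hTM : (m + 1) • T (levelSup S p (m + 1) m) ≤ T M := by
    have h := hT.1.mono (sum_range_le_of_disjoint hM (m + 1) (fun i _ => hSq0 i) hdisj hSM)
    simp only [map_sum, apply_iterate_eq hTS, Finset.sum_const, Finset.card_range] at h
    rwa [← hq, apply_iterate_eq hTS]
  have hTw : saturation S p ≤ (m + 1) • T (levelSup S p (m + 1) m) + m • T p := by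
    rw [← hsys.condExp_saturation hT herg hp]
    refine (hsys.condExp.orderContinuous.isLUB_map (sweep_monotone hR hp.1)
      (isLUB_saturation hR hSe hp)).2 ?_
    rintro _ ⟨N, rfl⟩
    -- The lengths m + N(m + 1) are cofinal, so bounding these sweeps suffices.
    have hN : N ≤ m + N * (m + 1) := by nlinarith
    refine (hT.1.mono (sweep_monotone hR hp.1 hN)).trans
      ((map_sweep_add_mul_le hR hp.1 hT.1 hTS m N).trans ?_)
    rw [← map_sum]
    gcongr
    refine hT.1.mono (sum_range_le_of_disjoint hr.1 N
      (fun j _ => (firstEntry_isComponent hR hSe hp _).1) (fun i _ j _ hij =>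
        firstEntry_inf_of_ne hR hSe hp fun h => hij ?_)
      fun j _ => (isLUB_levelSup hR hSe hp (m + 1) m).1 ⟨j, rfl⟩)
    exact Nat.eq_of_mul_eq_mul_right m.succ_pos (Nat.add_right_cancel h)
  have hcast : (((m + 1 : ℕ) : ℝ) - 1) • T p = m • T p := by
    rw [← Nat.cast_smul_eq_nsmul ℝ]
    push_cast
    rw [add_sub_cancel_right]
  rw [hcast, sub_le_iff_le_add]
  exact hTw.trans (by gcongr)
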